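/- Let $R$ be a commutative Noetherian ring with identity, let $\mathfrak a$ be an ideal of $R$ contained in the Jacobson radical of $R$, and let $M$ be a nonzero finitely generated $R$-module. Let $\mu(\mathfrak a)$ be the minimum number of generators of $\mathfrak a$. For a finitely generated $R$-module $N$, let $\operatorname{grade}(\mathfrak a,N)$ be the supremum of the lengths of the $N$-regular sequences contained in $\mathfrak a$ (and $\infty$ if $N=\mathfrak aN$), and let $\operatorname{cd}(\mathfrak a,N)$ be the largest integer $i$ such that the local cohomology module $\operatorname{H}^i_{\mathfrak a}(N)=\varinjlim_n\operatorname{Ext}^i_R(R/\mathfrak a^n,N)$ is nonzero. Say that $M$ is $\mathfrak a$-relative regular if either $M=\mathfrak aM$, or $M\neq\mathfrak aM$ and $\mathfrak a$ can be generated by an $M$-regular sequence of length $\operatorname{cd}(\mathfrak a,R)$ which is also an $R$-regular sequence. Then the following are equivalent: (i) $M$ is $\mathfrak a$-relative regular; (ii) $\operatorname{grade}(\mathfrak a,M)=\operatorname{grade}(\mathfrak a,R)=\mu(\mathfrak a)$. -/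

import Mathlib

universe u v

namespace RelativeRegular

/-- `cd(a, N)`: the largest `i` such that the local cohomology module `H^i_a(N)` is nonzero,
computed as a supremum in `WithBot ℕ∞`. -/
noncomputable def cd {R : Type u} [CommRing R] (a : Ideal R)
    (N : Type u) [AddCommGroup N] [Module R N] : WithBot ℕ∞ :=
  ⨆ i : {i : ℕ // ¬ CategoryTheory.Limits.IsZero ((localCohomology a i).obj (ModuleCat.of R N))},
    (((i : ℕ) : ℕ∞) : WithBot ℕ∞)

open Classical in
/-- `grade(a, M)`: the supremum of the lengths of the `M`-regular sequences contained in `a`,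
with the usual convention `grade(a, M) = ∞` when `a M = M`. -/
noncomputable def grade {R : Type u} [CommRing R] (a : Ideal R)
    (M : Type v) [AddCommGroup M] [Module R M] : ℕ∞ :=
  if a • (⊤ : Submodule R M) = ⊤ then ⊤
  else ⨆ rs : {rs : List R // (∀ r ∈ rs, r ∈ a) ∧ RingTheory.Sequence.IsRegular M rs},
    (rs.1.length : ℕ∞)

/-- `M` is `a`-relative regular: either `M = a M`, or `M ≠ a M` and `a` is generated by an
`M`-regular sequence of length `cd(a, R)` which is also an `R`-regular sequence.
(To be used for a finitely generated `M` and a proper ideal `a`.) -/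
def IsRelativeRegular {R : Type u} [CommRing R] (a : Ideal R)
    (M : Type v) [AddCommGroup M] [Module R M] : Prop :=
  (⊤ : Submodule R M) = a • ⊤ ∨
    ((⊤ : Submodule R M) ≠ a • ⊤ ∧
      ∃ rs : List R,
        Ideal.ofList rs = a ∧
        RingTheory.Sequence.IsRegular M rs ∧
        RingTheory.Sequence.IsRegular R rs ∧
        ((rs.length : ℕ∞) : WithBot ℕ∞) = cd a R)

end RelativeRegular

/-! Everything rests on `Ext(R/a, N)`. A weakly `N`-regular sequence in `a` of length `n` kills
`Ext^i` for `i < n`. Conversely, if `Ext^i` vanishes below the number of given generators, prime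
avoidance changes each generator `x` to `x + b`, with `b` in the ideal of the later ones, so that
the new generators are weakly regular, on two modules at once
(`exists_common_isWeaklyRegular_generators`). If vanishing went one degree further, `Hom(R/a, N/aN)`
would be zero, forcing `N = aN`; hence grade is at most `μ(a)`, and (i) gives (ii) by squeezing. For
(ii) to (i), sequences realizing both grades give vanishing for `M` and `R`, hence common regular
generators.

Their length is `cd(a, R)` by `cd_ofList_eq_length`. Above it, the transition maps of the `Ext`
system factor through `Ext` of quotients by powers of the generators, which have small projective
dimension; at it, the maps out of `Ext(R/a, R)` are injective and their source is nonzero. -/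

namespace RelativeRegular

open CategoryTheory Abelian RingTheory.Sequence
open scoped Pointwise

/-! ### Prime avoidance for cosets -/

section Avoidance

variable {R : Type u} [CommRing R]

/-- Coset version of prime avoidance. -/
lemma exists_add_notMem_of_finite {S : Set (Ideal R)} (hS : S.Finite)
    (hp : ∀ P ∈ S, P.IsPrime) (x : R) (b : Ideal R)
    (h : ∀ P ∈ S, ¬ Ideal.span {x} ⊔ b ≤ P) : ∃ y ∈ b, ∀ P ∈ S, x + y ∉ P := by
  let T : Set (Ideal R) := {P | Maximal (· ∈ S) P}
  have hTS : T ⊆ S := fun P hP ↦ hP.1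
  have hT : T.Finite := hS.subset hTS
  let T₁ : Set (Ideal R) := {P ∈ T | x ∈ P}
  let T₂ : Set (Ideal R) := {P ∈ T | x ∉ P}
  have hT₁ : T₁.Finite := hT.subset fun P hP ↦ hP.1
  have hT₂ : T₂.Finite := hT.subset fun P hP ↦ hP.1
  -- Only maximal members of `S` matter. The sought `y` lies in those missing `x` and avoids those
  -- containing `x`, so `x + y` avoids both kinds.
  have hnot : ¬ ((b ⊓ hT₂.toFinset.inf id : Ideal R) : Set R) ⊆ ⋃ P ∈ T₁, (P : Set R) := by
    intro hsub
    obtain ⟨P, hP, hle⟩ := (Ideal.subset_union_prime_finite hT₁ (f := id) ⊥ ⊥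
      (fun P hP _ _ ↦ hp P (hTS hP.1))).1 hsub
    have hPp := hp P (hTS hP.1)
    rcases hPp.inf_le.1 hle with hb | hi
    · exact h P (hTS hP.1) (sup_le ((Ideal.span_singleton_le_iff_mem _).2 hP.2) hb)
    · obtain ⟨Q, hQ, hQP⟩ := (hPp.inf_le').1 hi
      have hQ' : Q ∈ T₂ := by simpa using hQ
      have : Q = P := le_antisymm hQP (hQ'.1.2 (hTS hP.1) hQP)
      exact hQ'.2 (this ▸ hP.2)
  obtain ⟨y, hy, hyn⟩ := Set.not_subset.1 hnot
  refine ⟨y, hy.1, fun P hP hxy ↦ ?_⟩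
  obtain ⟨Q, hPQ, hQ⟩ := hS.exists_le_maximal hP
  have hxyQ := hPQ hxy
  by_cases hx : x ∈ Q
  · exact hyn (Set.mem_biUnion (show Q ∈ T₁ from ⟨hQ, hx⟩) ((Q.add_mem_iff_right hx).1 hxyQ))
  · refine hx ((Q.add_mem_iff_left ?_).1 hxyQ)
    have : hT₂.toFinset.inf id ≤ Q := Finset.inf_le (f := id) (by simpa using ⟨hQ, hx⟩)
    exact this hy.2

end Avoidance

/-! ### Regular sequences and vanishing of Ext -/

section ExtVanishing

variable {R : Type u} [CommRing R]

lemma subsingleton_ext_zero_iff (K N : ModuleCat.{u} R) :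
    Subsingleton (Ext K N 0) ↔ Subsingleton (K →ₗ[R] N) :=
  (Ext.homEquiv₀ (X := K) (Y := N)).subsingleton_congr.trans
    (ModuleCat.homEquiv (M := K) (N := N)).subsingleton_congr

/-- Multiplication by `r` on Ext can be computed in either argument, and on `K` it is zero. -/
lemma ext_comp_smulShortComplex_f_eq_zero {K N : ModuleCat.{u} R} {r : R}
    (hr : r ∈ Module.annihilator R K) {n : ℕ} (x : Ext K N n) :
    x.comp (Ext.mk₀ (N.smulShortComplex r).f) (add_zero n) = 0 := by
  have hK : r • 𝟙 K = 0 := by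
    ext k
    exact Module.mem_annihilator.1 hr k
  have h₁ : x.comp (Ext.mk₀ (r • 𝟙 N)) (add_zero n) = r • x := by simp [Ext.mk₀_smul]
  have h₂ : (Ext.mk₀ (r • 𝟙 K)).comp x (zero_add n) = r • x := by simp [Ext.mk₀_smul]
  have h₃ : (Ext.mk₀ (r • 𝟙 K)).comp x (zero_add n) = 0 := by
    rw [hK, Ext.mk₀_zero, Ext.zero_comp]
  exact h₁.trans (h₂.symm.trans h₃)

lemma subsingleton_ext_of_isWeaklyRegular (K : ModuleCat.{u} R) {N : Type u} [AddCommGroup N]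
    [Module R N] {rs : List R} (hrs : IsWeaklyRegular N rs)
    (hK : ∀ r ∈ rs, r ∈ Module.annihilator R K) {i : ℕ} (hi : i < rs.length) :
    Subsingleton (Ext K (ModuleCat.of R N) i) := by
  induction rs generalizing N i with
  | nil => simp at hi
  | cons r rs ih =>
    rw [isWeaklyRegular_cons_iff] at hrs
    have hr := hK r (by simp)
    cases i with
    | zero =>
      rw [subsingleton_ext_zero_iff]
      exact hrs.1.linearMap_subsingleton_of_mem_annihilator hr
    | succ j =>
      have := ih hrs.2 (fun r hr ↦ hK r (by simp [hr])) (i := j) (by simpa using hi)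
      have hS := IsSMulRegular.smulShortComplex_shortExact (M := ModuleCat.of R N) hrs.1
      refine subsingleton_of_forall_eq 0 fun x ↦ ?_
      obtain ⟨x₃, hx₃⟩ := Ext.covariant_sequence_exact₁ K hS x
        (ext_comp_smulShortComplex_f_eq_zero hr x) rfl
      rw [← hx₃, show x₃ = 0 from this.elim _ _]
      exact Ext.zero_comp K _ _ _ _

lemma subsingleton_ext_quotSMulTop (K : ModuleCat.{u} R) {N : Type u} [AddCommGroup N]
    [Module R N] {y : R} (hy : IsSMulRegular N y) {i : ℕ}
    (h₀ : Subsingleton (Ext K (ModuleCat.of R N) i))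
    (h₁ : Subsingleton (Ext K (ModuleCat.of R N) (i + 1))) :
    Subsingleton (Ext K (ModuleCat.of R (QuotSMulTop y N)) i) := by
  have hS := IsSMulRegular.smulShortComplex_shortExact (M := ModuleCat.of R N) hy
  refine subsingleton_of_forall_eq 0 fun x ↦ ?_
  obtain ⟨x₂, hx₂⟩ := Ext.covariant_sequence_exact₃ K hS x rfl (@Subsingleton.elim _ h₁ _ _)
  rw [← hx₂, show x₂ = 0 from h₀.elim _ _]
  exact Ext.zero_comp K _ _ _ _

lemma subsingleton_ext_of_linearEquiv (K : ModuleCat.{u} R) {N N' : Type u} [AddCommGroup N]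
    [Module R N] [AddCommGroup N'] [Module R N'] (e : N ≃ₗ[R] N') (i : ℕ)
    (h : Subsingleton (Ext K (ModuleCat.of R N) i)) :
    Subsingleton (Ext K (ModuleCat.of R N') i) := by
  refine subsingleton_of_forall_eq 0 fun x ↦ ?_
  have hx : x = (x.comp (Ext.mk₀ e.symm.toModuleIso.hom) (add_zero i)).comp
      (Ext.mk₀ e.symm.toModuleIso.inv) (add_zero i) := by
    rw [Ext.comp_assoc_of_third_deg_zero, Ext.mk₀_comp_mk₀, Iso.hom_inv_id, Ext.comp_mk₀_id]
  rw [hx, h.elim (x.comp _ _) 0, Ext.zero_comp]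

/-- Each regular element divided out costs one degree of vanishing, by the long exact sequence. -/
lemma subsingleton_ext_quotient_of_isWeaklyRegular (K : ModuleCat.{u} R) {N : Type u}
    [AddCommGroup N] [Module R N] {ys : List R} (hys : IsWeaklyRegular N ys) {k : ℕ}
    (h : ∀ i < ys.length + k, Subsingleton (Ext K (ModuleCat.of R N) i)) :
    ∀ i < k, Subsingleton (Ext K (ModuleCat.of R (N ⧸ (Ideal.ofList ys • ⊤ : Submodule R N))) i) := by
  induction ys generalizing N with
  | nil =>
    intro i hi
    refine subsingleton_ext_of_linearEquiv K
      (Submodule.quotEquivOfEqBot (Ideal.ofList [] • ⊤ : Submodule R N) ?_).symm i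
      (h i (by simpa using hi))
    rw [Ideal.ofList_nil, Submodule.bot_smul]
  | cons y ys ih =>
    rw [isWeaklyRegular_cons_iff] at hys
    intro i hi
    refine subsingleton_ext_of_linearEquiv K
      (Submodule.quotOfListConsSMulTopEquivQuotSMulTopInner N y ys).symm i
      (ih hys.2 (fun j hj ↦ subsingleton_ext_quotSMulTop K hys.1 (h j ?_) (h (j + 1) ?_)) i hi)
    all_goals simp only [List.length_cons]; omega

end ExtVanishing

/-! ### Regular generators and the bound of grade by `μ(a)` -/

section Generators

lemma spanFinrank_ofList_le {R : Type u} [CommRing R] (xs : List R) :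
    Submodule.spanFinrank (Ideal.ofList xs) ≤ xs.length := by
  classical
  have : Ideal.ofList xs = Submodule.span R (xs.toFinset : Set R) := by
    simp [Ideal.ofList, Ideal.span]
  rw [this]
  refine (Submodule.spanFinrank_span_le_ncard_of_finite (Finset.finite_toSet _)).trans ?_
  rw [Set.ncard_coe_finset]
  exact List.toFinset_card_le xs

variable {R : Type u} [CommRing R] [IsNoetherianRing R]

lemma not_le_associatedPrime_of_subsingleton_ext {a : Ideal R} {N : Type u} [AddCommGroup N]
    [Module R N] [Module.Finite R N]
    (h : Subsingleton (Ext (ModuleCat.of R (R ⧸ a)) (ModuleCat.of R N) 0))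
    {P : Ideal R} (hP : P ∈ associatedPrimes R N) : ¬ a ≤ P := by
  rw [subsingleton_ext_zero_iff] at h
  obtain ⟨r, hr, hreg⟩ := IsSMulRegular.subsingleton_linearMap_iff.1 h
  intro hle
  have hrP : r ∈ P := hle (by simpa [Ideal.annihilator_quotient] using hr)
  have : r ∈ ⋃ p ∈ associatedPrimes R N, (p : Set R) := Set.mem_biUnion hP hrP
  rw [biUnion_associatedPrimes_eq_compl_regular] at this
  exact this hreg

lemma isSMulRegular_of_forall_notMem {N : Type u} [AddCommGroup N] [Module R N] {y : R}
    (h : ∀ P ∈ associatedPrimes R N, y ∉ P) : IsSMulRegular N y := by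
  by_contra hy
  have : y ∈ ⋃ p ∈ associatedPrimes R N, (p : Set R) := by
    rw [biUnion_associatedPrimes_eq_compl_regular]
    exact hy
  obtain ⟨P, hP, hyP⟩ := Set.mem_iUnion₂.1 this
  exact h P hP hyP

/-- An ideal generated by `m` elements over an ideal annihilating two modules with
`Ext`-depth at least `m` is generated by `m` elements which form a weakly regular sequence on
both modules. -/
lemma exists_common_isWeaklyRegular_generators (a : Ideal R) (xs : List R) (J : Ideal R)
    (N₁ N₂ : Type u) [AddCommGroup N₁] [Module R N₁] [Module.Finite R N₁]
    [AddCommGroup N₂] [Module R N₂] [Module.Finite R N₂]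
    (hJ₁ : J ≤ Module.annihilator R N₁) (hJ₂ : J ≤ Module.annihilator R N₂)
    (ha : a = J ⊔ Ideal.ofList xs)
    (h₁ : ∀ i < xs.length, Subsingleton (Ext (ModuleCat.of R (R ⧸ a)) (ModuleCat.of R N₁) i))
    (h₂ : ∀ i < xs.length, Subsingleton (Ext (ModuleCat.of R (R ⧸ a)) (ModuleCat.of R N₂) i)) :
    ∃ ys : List R, ys.length = xs.length ∧ a = J ⊔ Ideal.ofList ys ∧
      IsWeaklyRegular N₁ ys ∧ IsWeaklyRegular N₂ ys := by
  induction xs generalizing J N₁ N₂ with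
  | nil => exact ⟨[], rfl, ha, .nil R N₁, .nil R N₂⟩
  | cons x xs ih =>
    have hann : ∀ P ∈ associatedPrimes R N₁ ∪ associatedPrimes R N₂, J ≤ P ∧ ¬ a ≤ P := by
      rintro P (hP | hP)
      · exact ⟨hJ₁.trans (Submodule.annihilator_top (R := R) (M := N₁) ▸
          IsAssociatedPrime.annihilator_le hP),
          not_le_associatedPrime_of_subsingleton_ext (h₁ 0 (by simp)) hP⟩
      · exact ⟨hJ₂.trans (Submodule.annihilator_top (R := R) (M := N₂) ▸
          IsAssociatedPrime.annihilator_le hP),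
          not_le_associatedPrime_of_subsingleton_ext (h₂ 0 (by simp)) hP⟩
    obtain ⟨b, hb, hxb⟩ := exists_add_notMem_of_finite
      ((associatedPrimes.finite R N₁).union (associatedPrimes.finite R N₂))
      (by rintro P (hP | hP) <;> exact hP.isPrime) x (Ideal.ofList xs) (by
        intro P hP hle
        rw [← Ideal.ofList_cons] at hle
        exact (hann P hP).2 (ha ▸ sup_le (hann P hP).1 hle))
    have hy₁ : IsSMulRegular N₁ (x + b) := isSMulRegular_of_forall_notMem fun P hP ↦
      hxb P (Or.inl hP)
    have hy₂ : IsSMulRegular N₂ (x + b) := isSMulRegular_of_forall_notMem fun P hP ↦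
      hxb P (Or.inr hP)
    have hspan : Ideal.span {x} ⊔ Ideal.ofList xs = Ideal.span {x + b} ⊔ Ideal.ofList xs := by
      apply le_antisymm <;> refine sup_le ?_ le_sup_right <;>
        rw [Ideal.span_singleton_le_iff_mem]
      · have := sub_mem (Ideal.mem_sup_left (T := Ideal.ofList xs)
          (Ideal.mem_span_singleton_self (x + b))) (Ideal.mem_sup_right (S := Ideal.span {x + b}) hb)
        simpa using this
      · exact add_mem (Ideal.mem_sup_left (Ideal.mem_span_singleton_self x))
          (Ideal.mem_sup_right hb)
    have hquot : ∀ (N : Type u) [AddCommGroup N] [Module R N], J ≤ Module.annihilator R N →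
        J ⊔ Ideal.span {x + b} ≤ Module.annihilator R (QuotSMulTop (x + b) N) := by
      intro N _ _ hJ
      refine sup_le (hJ.trans (LinearMap.annihilator_le_of_surjective _
        (Submodule.mkQ_surjective _))) ?_
      rw [Ideal.span_singleton_le_iff_mem]
      exact QuotSMulTop.mem_annihilator N (x + b)
    obtain ⟨ys, hlen, hys, hys₁, hys₂⟩ := ih (J ⊔ Ideal.span {x + b})
      (QuotSMulTop (x + b) N₁) (QuotSMulTop (x + b) N₂) (hquot N₁ hJ₁) (hquot N₂ hJ₂)
      (by rw [ha, Ideal.ofList_cons, hspan, sup_assoc])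
      (fun i hi ↦ subsingleton_ext_quotSMulTop _ hy₁ (h₁ i (by simp; omega))
        (h₁ (i + 1) (by simpa using hi)))
      (fun i hi ↦ subsingleton_ext_quotSMulTop _ hy₂ (h₂ i (by simp; omega))
        (h₂ (i + 1) (by simpa using hi)))
    exact ⟨(x + b) :: ys, by simp [hlen], by rw [hys, Ideal.ofList_cons, sup_assoc],
      hys₁.cons hy₁, hys₂.cons hy₂⟩

lemma exists_list_length_eq_spanFinrank (a : Ideal R) :
    ∃ xs : List R, xs.length = Submodule.spanFinrank a ∧ Ideal.ofList xs = a := by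
  obtain ⟨s, hs, hspan⟩ :=
    (IsNoetherian.noetherian a).exists_span_finset_card_eq_spanFinrank
  exact ⟨s.toList, by simpa using hs, by simpa [Ideal.ofList] using hspan⟩

/-- If `aN ≠ N`, some `Ext^i(R/a, N)` with `i` at most the number of generators of `a` is
nonzero. -/
lemma exists_not_subsingleton_ext (a : Ideal R) (N : Type u) [AddCommGroup N] [Module R N]
    [Module.Finite R N] (hN : (a • ⊤ : Submodule R N) ≠ ⊤) :
    ∃ i ≤ Submodule.spanFinrank a,
      ¬ Subsingleton (Ext (ModuleCat.of R (R ⧸ a)) (ModuleCat.of R N) i) := by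
  by_contra! h
  obtain ⟨xs, hlen, hxs⟩ := exists_list_length_eq_spanFinrank a
  have h' : ∀ i < xs.length,
      Subsingleton (Ext (ModuleCat.of R (R ⧸ a)) (ModuleCat.of R N) i) :=
    fun i hi ↦ h i (by omega)
  obtain ⟨ys, hyl, hys, hreg, -⟩ := exists_common_isWeaklyRegular_generators a xs ⊥ N N
    bot_le bot_le (by simp [hxs]) h' h'
  rw [bot_sup_eq] at hys
  -- `k = 1` leaves exactly degree zero: `Hom(R/a, N/aN) = 0`. The map sending `1` to the class of
  -- `z` then shows `z ∈ aN`.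
  have := subsingleton_ext_quotient_of_isWeaklyRegular (ModuleCat.of R (R ⧸ a)) hreg (k := 1)
    (fun i hi ↦ h i (by omega)) 0 one_pos
  rw [subsingleton_ext_zero_iff, ← hys] at this
  apply hN
  rw [eq_top_iff]
  intro z _
  let f : R ⧸ a →ₗ[R] N ⧸ (a • ⊤ : Submodule R N) :=
    Submodule.liftQ a (LinearMap.toSpanSingleton R _ (Submodule.Quotient.mk z)) (by
      intro r hr
      rw [LinearMap.mem_ker, LinearMap.toSpanSingleton_apply, ← Submodule.Quotient.mk_smul,
        Submodule.Quotient.mk_eq_zero]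
      exact Submodule.smul_mem_smul hr trivial)
  have hf : f (Submodule.Quotient.mk 1) = 0 := by
    rw [show f = 0 from this.elim _ _]; rfl
  rw [← Submodule.Quotient.mk_eq_zero, ← hf]
  exact (one_smul R _).symm

lemma length_le_spanFinrank_of_isWeaklyRegular (a : Ideal R) (N : Type u) [AddCommGroup N]
    [Module R N] [Module.Finite R N] (hN : (a • ⊤ : Submodule R N) ≠ ⊤) {rs : List R}
    (hrs : IsWeaklyRegular N rs) (hmem : ∀ r ∈ rs, r ∈ a) :
    rs.length ≤ Submodule.spanFinrank a := by
  obtain ⟨i, hi, hi'⟩ := exists_not_subsingleton_ext a N hN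
  by_contra! hlt
  exact hi' (subsingleton_ext_of_isWeaklyRegular _ hrs
    (by simpa [Ideal.annihilator_quotient] using hmem) (by omega))

end Generators

/-! ### Powers of regular sequences and projective dimension -/

section Powers

variable {R : Type u} [CommRing R]

lemma isWeaklyRegular_append_singleton_pow {N : Type u} [AddCommGroup N] [Module R N]
    {rs : List R} {r : R} (h : IsWeaklyRegular N (rs ++ [r])) (k : ℕ) :
    IsWeaklyRegular N (rs ++ [r ^ k]) := by
  rw [isWeaklyRegular_append_iff, isWeaklyRegular_singleton_iff] at h ⊢
  exact ⟨h.1, h.2.pow k⟩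

/-- The last term may always be replaced by a power; inside the Jacobson radical the sequence can be
permuted, so each term is moved to the end in turn. -/
lemma isWeaklyRegular_append_map_pow {N : Type u} [AddCommGroup N] [Module R N]
    [IsNoetherian R N] {k : ℕ} (hk : 0 < k) (zs : List R) (ys : List R)
    (hJ : ∀ r ∈ ys ++ zs, r ∈ Ring.jacobson R) (h : IsWeaklyRegular N (ys ++ zs)) :
    IsWeaklyRegular N (ys ++ zs.map (· ^ k)) := by
  have hmem : ∀ {l : List R}, (∀ r ∈ l, r ∈ Ring.jacobson R) →
      ∀ r ∈ l, r ∈ (Module.annihilator R N).jacobson :=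
    fun h r hr ↦ Ideal.ringJacobson_le_jacobson (h r hr)
  induction zs generalizing ys with
  | nil => simpa using h
  | cons z zs ih =>
    have hperm : (ys ++ z :: zs).Perm ((ys ++ zs) ++ [z]) :=
      List.perm_middle.trans (List.perm_append_singleton z (ys ++ zs)).symm
    have h₁ := isWeaklyRegular_append_singleton_pow
      (h.of_perm_of_subset_jacobson_annihilator hperm (hmem hJ)) k
    have hJ' : ∀ r ∈ (ys ++ zs) ++ [z ^ k], r ∈ Ring.jacobson R := by
      intro r hr
      rcases List.mem_append.1 hr with hr | hr
      · exact hJ r (by simp only [List.mem_append, List.mem_cons] at hr ⊢; tauto)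
      · rw [List.mem_singleton.1 hr]
        exact Ideal.pow_mem_of_mem _ (hJ z (by simp)) k hk
    have hperm' : ((ys ++ zs) ++ [z ^ k]).Perm ((ys ++ [z ^ k]) ++ zs) := by
      rw [List.append_assoc, List.append_assoc]
      exact List.perm_append_comm.append_left ys
    have h₂ := ih (ys ++ [z ^ k]) (fun r hr ↦ hJ' r (hperm'.mem_iff.2 hr))
      (h₁.of_perm_of_subset_jacobson_annihilator hperm' (hmem hJ'))
    simpa using h₂

lemma hasProjectiveDimensionLT_quotient_of_isWeaklyRegular {N : Type u} [AddCommGroup N]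
    [Module R N] {rs : List R} (hrs : IsWeaklyRegular N rs) (k : ℕ)
    (hN : HasProjectiveDimensionLT (ModuleCat.of R N) (k + 1)) :
    HasProjectiveDimensionLT
      (ModuleCat.of R (N ⧸ (Ideal.ofList rs • ⊤ : Submodule R N))) (rs.length + k + 1) := by
  induction rs generalizing N k with
  | nil =>
    simp only [List.length_nil, zero_add]
    refine hasProjectiveDimensionLT_of_iso (LinearEquiv.toModuleIso
      (Submodule.quotEquivOfEqBot (Ideal.ofList [] • ⊤ : Submodule R N) ?_).symm) (k + 1)
    rw [Ideal.ofList_nil, Submodule.bot_smul]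
  | cons r rs ih =>
    rw [isWeaklyRegular_cons_iff] at hrs
    have hS := IsSMulRegular.smulShortComplex_shortExact (M := ModuleCat.of R N) hrs.1
    have h3 : HasProjectiveDimensionLT (ModuleCat.of R (QuotSMulTop r N)) (k + 1 + 1) :=
      hS.hasProjectiveDimensionLT_X₃ (k + 1) hN
        (hasProjectiveDimensionLT_of_ge (ModuleCat.of R N) (k + 1) (k + 2) (by omega))
    have := ih hrs.2 (k + 1) h3
    have h4 := hasProjectiveDimensionLT_of_iso (LinearEquiv.toModuleIso
      (Submodule.quotOfListConsSMulTopEquivQuotSMulTopInner N r rs).symm) (rs.length + (k + 1) + 1)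
    simpa [add_assoc, add_comm, add_left_comm] using h4

end Powers

end RelativeRegular

namespace RelativeRegular

open CategoryTheory RingTheory.Sequence Limits
open scoped Pointwise

/-! ### Injectivity on homology, by elements -/

section Homology

variable {R : Type u} [Ring R]

lemma homologyπ_apply_eq_zero_iff (S : ShortComplex (ModuleCat.{u} R)) (c : S.cycles) :
    S.homologyπ c = 0 ↔ ∃ w : S.X₁, S.f w = S.iCycles c := by
  have hex : (ShortComplex.mk S.toCycles S.homologyπ S.toCycles_comp_homologyπ).Exact :=
    ShortComplex.exact_of_g_is_cokernel _ S.homologyIsCokernel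
  rw [ShortComplex.moduleCat_exact_iff] at hex
  have hi : Function.Injective S.iCycles := (ModuleCat.mono_iff_injective _).1 inferInstance
  constructor
  · intro h
    obtain ⟨w, hw⟩ := hex c h
    refine ⟨w, ?_⟩
    rw [← hw]
    exact (ConcreteCategory.congr_hom S.toCycles_i w).symm
  · rintro ⟨w, hw⟩
    have : S.toCycles w = c := hi ((ConcreteCategory.congr_hom S.toCycles_i w).trans hw)
    rw [← this]
    exact ConcreteCategory.congr_hom S.toCycles_comp_homologyπ w

lemma mono_homologyMap_of_forall {S T : ShortComplex (ModuleCat.{u} R)} (γ : S ⟶ T)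
    (h : ∀ z : S.X₂, S.g z = 0 → (∃ w : T.X₁, T.f w = γ.τ₂ z) → ∃ w : S.X₁, S.f w = z) :
    Mono (ShortComplex.homologyMap γ) := by
  rw [ModuleCat.mono_iff_injective, injective_iff_map_eq_zero]
  intro x hx
  obtain ⟨c, rfl⟩ := (ModuleCat.epi_iff_surjective S.homologyπ).1 inferInstance x
  have h₁ : T.homologyπ (ShortComplex.cyclesMap γ c) = 0 :=
    (ConcreteCategory.congr_hom (ShortComplex.homologyπ_naturality γ) c).symm.trans hx
  rw [homologyπ_apply_eq_zero_iff] at h₁ ⊢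
  refine h _ (ConcreteCategory.congr_hom S.iCycles_g c) ?_
  obtain ⟨w, hw⟩ := h₁
  exact ⟨w, hw.trans (ConcreteCategory.congr_hom (ShortComplex.cyclesMap_i γ) c)⟩

end Homology

/-! ### Comparing derived-functor `Ext` with `Abelian.Ext` -/

section LeftDerivedExt

variable {R : Type u} [CommRing R]

lemma extMk_zero_eq_zero_iff {X Y : ModuleCat.{u} R} (P : ProjectiveResolution X)
    (f : P.complex.X 0 ⟶ Y) (hf : P.complex.d 1 0 ≫ f = 0) :
    P.extMk f 1 rfl hf = 0 ↔ f = 0 := by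
  refine ⟨fun h ↦ ?_, fun h ↦ by subst h; simp⟩
  rw [← P.extEquivCohomologyClass.apply_eq_iff_eq, P.extEquivCohomologyClass_extMk,
    P.extEquivCohomologyClass_zero, CochainComplex.HomComplex.CohomologyClass.mk_eq_zero_iff,
    CochainComplex.HomComplex.Cocycle.toSingleMk_mem_coboundaries_iff _ _ _ _ _ 1 (by simp)] at h
  obtain ⟨g, hg⟩ := h
  have : IsZero (P.cochainComplex.X 1) :=
    CochainComplex.isZero_of_isStrictlyLE _ 0 1 (by simp)
  rw [this.eq_of_src g 0, comp_zero] at hg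
  exact (cancel_epi (P.cochainComplexXIso (-(0 : ℕ)) 0 rfl).hom).1 (by simpa using hg.symm)

lemma extMk_eq_zero_iff_exists {X Y : ModuleCat.{u} R} (P : ProjectiveResolution X) {n : ℕ}
    (f : P.complex.X n ⟶ Y) (hf : P.complex.d (n + 1) n ≫ f = 0) :
    P.extMk f (n + 1) rfl hf = 0 ↔
      ∃ g : P.complex.X ((ComplexShape.up ℕ).prev n) ⟶ Y,
        P.complex.d n ((ComplexShape.up ℕ).prev n) ≫ g = f := by
  cases n with
  -- In degree zero `prev` is `0` itself and the differential is zero, so only `f = 0` is a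
  -- boundary.
  | zero =>
    rw [extMk_zero_eq_zero_iff]
    simp [eq_comm]
  | succ p =>
    rw [CochainComplex.prev_nat_succ]
    exact P.extMk_eq_zero_iff f (p + 2) rfl hf p rfl

lemma linearYonedaObj_sc_g_apply {X Y : ModuleCat.{u} R} (P : ProjectiveResolution X) (n : ℕ)
    (f : P.complex.X n ⟶ Y) :
    ((P.complex.linearYonedaObj R Y).sc n).g f = 0 ↔ P.complex.d (n + 1) n ≫ f = 0 := by
  change (P.complex.linearYonedaObj R Y).d n ((ComplexShape.up ℕ).next n) f = 0 ↔ _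
  rw [CochainComplex.next]
  exact Iff.rfl

lemma isZero_ext_iff (X Y : ModuleCat.{u} R) (n : ℕ) :
    IsZero (((Ext R (ModuleCat.{u} R) n).obj (Opposite.op X)).obj Y) ↔
      Subsingleton (Abelian.Ext X Y n) := by
  let P := projectiveResolution X
  rw [(P.isoExt (R := R) n Y).isZero_iff, ← HomologicalComplex.exactAt_iff_isZero_homology,
    HomologicalComplex.exactAt_iff, ShortComplex.moduleCat_exact_iff]
  constructor
  · intro h
    refine subsingleton_of_forall_eq 0 fun α ↦ ?_
    obtain ⟨f, hf, rfl⟩ := P.extMk_surjective α (n + 1) rfl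
    rw [extMk_eq_zero_iff_exists]
    exact h f ((linearYonedaObj_sc_g_apply P n f).2 hf)
  · intro h z hz
    have hf := (linearYonedaObj_sc_g_apply P n z).1 hz
    exact (extMk_eq_zero_iff_exists P z hf).1 (h.elim _ _)

lemma epi_of_comp_iso_eq {C : Type*} [Category* C] {W X Y Z : C} (g : W ⟶ X) (e : X ≅ Y)
    (e' : W ≅ Z) (k : Z ⟶ Y) (h : g ≫ e.hom = e'.hom ≫ k) [Epi k] : Epi g := by
  rw [← Iso.eq_comp_inv] at h
  rw [h]
  infer_instance

/-- The functor `Ext` is an unopposed left derived functor, so the claim becomes an epimorphism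
there; on cocycles the map is precomposition with a lift of `f`, as in `Abelian.Ext`. -/
lemma mono_ext_map_app {X X' : ModuleCat.{u} R} (f : X ⟶ X') (Y : ModuleCat.{u} R) (n : ℕ)
    (h : ∀ α : Abelian.Ext X' Y n, (Abelian.Ext.mk₀ f).comp α (zero_add n) = 0 → α = 0) :
    Mono (((Ext R (ModuleCat.{u} R) n).map f.op).app Y) := by
  let P := projectiveResolution X
  let P' := projectiveResolution X'
  let φ : ProjectiveResolution.Hom P P' f :=
    ⟨ProjectiveResolution.lift f P P', by simpa using ProjectiveResolution.lift_commutes_zero f P P'⟩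
  let F := ((linearYoneda R (ModuleCat.{u} R)).obj Y).rightOp
  let g := (F.mapHomologicalComplex (ComplexShape.down ℕ)).map φ.hom
  let γ : P'.complex.linearYonedaObj R Y ⟶ P.complex.linearYonedaObj R Y :=
    (HomologicalComplex.unopFunctor _ _).map g.op
  have hγ : Mono (HomologicalComplex.homologyMap γ n) := by
    refine mono_homologyMap_of_forall _ fun (z : P'.complex.X n ⟶ Y) hz hw ↦ ?_
    have hf := (linearYonedaObj_sc_g_apply P' n z).1 hz
    have hf' : P.complex.d (n + 1) n ≫ φ.hom.f n ≫ z = 0 := by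
      rw [← φ.hom.comm_assoc, hf, comp_zero]
    have h₀ : P.extMk (φ.hom.f n ≫ z) (n + 1) rfl hf' = 0 :=
      (extMk_eq_zero_iff_exists P _ hf').2 hw
    rw [← ProjectiveResolution.mk₀_comp_extMk z (n + 1) rfl hf φ] at h₀
    exact (extMk_eq_zero_iff_exists P' z hf).1 (h _ h₀)
  have hepi : Epi (HomologicalComplex.homologyMap g n) := by
    have hnat : HomologicalComplex.homologyMap g n ≫
        ((P'.complex.linearYonedaObj R Y).homologyOp n).hom =
          ((P.complex.linearYonedaObj R Y).homologyOp n).hom ≫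
            (HomologicalComplex.homologyMap γ n).op :=
      HomologicalComplex.homologyOp_hom_naturality γ n
    exact epi_of_comp_iso_eq _ ((P'.complex.linearYonedaObj R Y).homologyOp n)
      ((P.complex.linearYonedaObj R Y).homologyOp n) _ hnat
  have hd : Epi ((F.leftDerived n).map f) := by
    have hnat := ProjectiveResolution.isoLeftDerivedObj_hom_naturality f P P' φ.hom
      (ProjectiveResolution.lift_commutes_zero f P P') F n
    have : Epi ((F.mapHomologicalComplex (ComplexShape.down ℕ) ⋙
      HomologicalComplex.homologyFunctor _ _ n).map φ.hom) := hepi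
    exact epi_of_comp_iso_eq _ _ _ _ hnat
  exact inferInstanceAs (Mono ((F.leftDerived n).map f).unop)

end LeftDerivedExt

/-! ### Vanishing of a filtered colimit, by elements -/

section LocalCohomology

variable {R : Type u} [CommRing R]

lemma isZero_localCohomology_iff (a : Ideal R) (i : ℕ) (M : ModuleCat.{u} R) :
    IsZero ((localCohomology a i).obj M) ↔
      ∀ (t : ℕ) (x : ((Ext R (ModuleCat.{u} R) i).obj
          (Opposite.op (ModuleCat.of R (R ⧸ a ^ t)))).obj M),
        ∃ (s : ℕ) (h : t ≤ s), (((Ext R (ModuleCat.{u} R) i).map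
          (ModuleCat.ofHom (Submodule.factor (Ideal.pow_le_pow_right (I := a) h))).op).app M) x
            = 0 := by
  let D := localCohomology.diagram (localCohomology.idealPowersDiagram a) i
  let ev := (evaluation (ModuleCat.{u} R) (ModuleCat.{u} R)).obj M
  have hc : IsColimit (ev.mapCocone (colimit.cocone D)) :=
    isColimitOfPreserves ev (colimit.isColimit D)
  have : PreservesFilteredColimitsOfSize.{0, 0} (forget (ModuleCat.{u} R)) :=
    preservesFilteredColimitsOfSize_shrink.{0, u, 0, u} _
  have : PreservesColimitsOfShape ℕᵒᵖᵒᵖ (forget (ModuleCat.{u} R)) :=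
    PreservesFilteredColimitsOfSize.preserves_filtered_colimits _
  rw [show IsZero ((localCohomology a i).obj M) ↔
    Subsingleton (ev.mapCocone (colimit.cocone D)).pt from ModuleCat.isZero_iff_subsingleton]
  constructor
  · intro h t x
    obtain ⟨k, f, g, hfg⟩ := Concrete.isColimit_exists_of_rep_eq (D ⋙ ev) hc
      (i := Opposite.op (Opposite.op t)) (j := Opposite.op (Opposite.op t)) x 0 (h.elim _ _)
    refine ⟨k.unop.unop, f.unop.unop.down.down, ?_⟩
    exact hfg.trans (map_zero _)
  · intro h
    refine subsingleton_of_forall_eq 0 fun y ↦ ?_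
    obtain ⟨j, x, rfl⟩ := Concrete.isColimit_exists_rep (D ⋙ ev) hc y
    obtain ⟨s, hs, hx⟩ := h j.unop.unop x
    let f : j ⟶ Opposite.op (Opposite.op s) := (homOfLE hs).op.op
    have hw := ConcreteCategory.congr_hom ((ev.mapCocone (colimit.cocone D)).w f) x
    have hx' : (D ⋙ ev).map f x = 0 := hx
    exact hw.symm.trans ((congrArg ((ev.mapCocone (colimit.cocone D)).ι.app
      (Opposite.op (Opposite.op s))).hom hx').trans (map_zero _))

end LocalCohomology

end RelativeRegular

namespace RelativeRegular

open CategoryTheory RingTheory.Sequence Limits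
open scoped Pointwise

/-! ### Cohomological dimension of a regular sequence -/

section CohomologicalDimension

variable {R : Type u} [CommRing R]

lemma ext_eq_zero_of_mk₀_comp_eq_zero {S : ShortComplex (ModuleCat.{u} R)} (hS : S.ShortExact)
    {Y : ModuleCat.{u} R} {n : ℕ} (h : ∀ k, k + 1 = n → Subsingleton (Abelian.Ext S.X₁ Y k))
    (α : Abelian.Ext S.X₃ Y n) (hα : (Abelian.Ext.mk₀ S.g).comp α (zero_add n) = 0) : α = 0 := by
  cases n with
  | zero =>
    obtain ⟨g, rfl⟩ := (Abelian.Ext.mk₀_bijective _ _).2 α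
    have := hS.epi_g
    rw [Abelian.Ext.mk₀_comp_mk₀, Abelian.Ext.mk₀_eq_zero_iff] at hα
    rw [(cancel_epi S.g).1 (hα.trans comp_zero.symm), Abelian.Ext.mk₀_zero]
  | succ k =>
    obtain ⟨β, hβ⟩ := Abelian.Ext.contravariant_sequence_exact₃ hS Y α hα (add_comm 1 k)
    rw [← hβ, (h k rfl).elim β 0, Abelian.Ext.comp_zero]

lemma ofList_map_pow_le (xs : List R) (k : ℕ) :
    Ideal.ofList (xs.map (· ^ k)) ≤ Ideal.ofList xs ^ k := by
  refine Ideal.span_le.2 fun r hr ↦ ?_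
  obtain ⟨x, hx, rfl⟩ := List.mem_map.1 hr
  exact Ideal.pow_mem_pow (Ideal.subset_span (s := {x | x ∈ xs}) hx) k

variable [IsNoetherianRing R]

lemma exists_pow_le_ofList_map_pow (xs : List R) (k : ℕ) :
    ∃ s, Ideal.ofList xs ^ s ≤ Ideal.ofList (xs.map (· ^ k)) := by
  refine Ideal.exists_pow_le_of_le_radical_of_fg (Ideal.span_le.2 fun r hr ↦ ⟨k, ?_⟩)
    (IsNoetherian.noetherian _)
  exact Ideal.subset_span (s := {x | x ∈ xs.map (· ^ k)}) (List.mem_map.2 ⟨r, hr, rfl⟩)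

lemma isZero_localCohomology_of_isWeaklyRegular (xs : List R)
    (hJ : Ideal.ofList xs ≤ Ring.jacobson R) (hreg : IsWeaklyRegular R xs) (M : ModuleCat.{u} R)
    {i : ℕ} (hi : xs.length < i) : IsZero ((localCohomology (Ideal.ofList xs) i).obj M) := by
  rw [isZero_localCohomology_iff]
  intro t x
  have hmem : ∀ r ∈ xs, r ∈ Ring.jacobson R := fun r hr ↦ hJ (Ideal.subset_span (s := {x | x ∈ xs}) hr)
  -- The exponent `t + 1` keeps it positive when `t = 0`.
  have hreg' : IsWeaklyRegular R (xs.map (· ^ (t + 1))) := by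
    simpa using isWeaklyRegular_append_map_pow (N := R) t.succ_pos xs [] (by simpa using hmem)
      (by simpa using hreg)
  have hpd := hasProjectiveDimensionLT_quotient_of_isWeaklyRegular hreg' 0 inferInstance
  obtain ⟨s, hs⟩ := exists_pow_le_ofList_map_pow xs (t + 1)
  have hle : Ideal.ofList (xs.map (· ^ (t + 1))) ≤ Ideal.ofList xs ^ t :=
    (ofList_map_pow_le xs (t + 1)).trans (Ideal.pow_le_pow_right (by omega))
  have hs' : Ideal.ofList xs ^ (max s t) ≤ Ideal.ofList (xs.map (· ^ (t + 1))) :=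
    (Ideal.pow_le_pow_right (le_max_left _ _)).trans hs
  have hz : IsZero (((Ext R (ModuleCat.{u} R) i).obj (Opposite.op
      (ModuleCat.of R (R ⧸ Ideal.ofList (xs.map (· ^ (t + 1))))))).obj M) := by
    rw [isZero_ext_iff]
    have : HasProjectiveDimensionLT
        (ModuleCat.of R (R ⧸ Ideal.ofList (xs.map (· ^ (t + 1))))) (xs.length + 1) := by
      have h := hasProjectiveDimensionLT_of_iso (LinearEquiv.toModuleIso
        (Submodule.quotEquivOfEq (Ideal.ofList (xs.map (· ^ (t + 1))) • ⊤ : Submodule R R)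
          (Ideal.ofList (xs.map (· ^ (t + 1)))) (by simp)))
        ((xs.map (· ^ (t + 1))).length + 0 + 1)
      simpa using h
    exact HasProjectiveDimensionLT.subsingleton _ (xs.length + 1) i hi M
  refine ⟨max s t, le_max_right _ _, ?_⟩
  have hfac : ModuleCat.ofHom (Submodule.factor
      (Ideal.pow_le_pow_right (I := Ideal.ofList xs) (le_max_right s t))) =
      ModuleCat.ofHom (Submodule.factor hs') ≫ ModuleCat.ofHom (Submodule.factor hle) := by
    ext
    rfl
  rw [hfac, op_comp, Functor.map_comp, NatTrans.comp_app, ModuleCat.comp_apply]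
  have : Subsingleton (((Ext R (ModuleCat.{u} R) i).obj (Opposite.op
      (ModuleCat.of R (R ⧸ Ideal.ofList (xs.map (· ^ (t + 1))))))).obj M) :=
    ModuleCat.isZero_iff_subsingleton.1 hz
  refine Eq.trans (congrArg _ (Subsingleton.elim _ 0)) (map_zero _)

lemma not_isZero_localCohomology_of_isWeaklyRegular (xs : List R)
    (hJ : Ideal.ofList xs ≤ Ring.jacobson R) (N : Type u) [AddCommGroup N] [Module R N]
    [Module.Finite R N] [Nontrivial N] (hreg : IsWeaklyRegular N xs) :
    ¬ IsZero ((localCohomology (Ideal.ofList xs) xs.length).obj (ModuleCat.of R N)) := by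
  set a := Ideal.ofList xs with ha
  have hmem : ∀ r ∈ xs, r ∈ Ring.jacobson R := fun r hr ↦ hJ (Ideal.subset_span (s := {x | x ∈ xs}) hr)
  have hN : (a • ⊤ : Submodule R N) ≠ ⊤ :=
    (Submodule.top_ne_ideal_smul_of_le_jacobson_annihilator
      (hJ.trans Ideal.ringJacobson_le_jacobson)).symm
  have hext : ¬ Subsingleton (Abelian.Ext (ModuleCat.of R (R ⧸ a ^ 1)) (ModuleCat.of R N)
      xs.length) := by
    obtain ⟨i, hi, hns⟩ := exists_not_subsingleton_ext a N hN
    have hlen : i ≤ xs.length := hi.trans (spanFinrank_ofList_le xs)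
    have hge : xs.length ≤ i := by
      by_contra! hlt
      exact hns (subsingleton_ext_of_isWeaklyRegular _ hreg
        (fun r hr ↦ by simpa [Ideal.annihilator_quotient] using Ideal.subset_span (s := {x | x ∈ xs}) hr) hlt)
    rw [pow_one, ← le_antisymm hlen hge]
    exact hns
  rw [← isZero_ext_iff, ModuleCat.isZero_iff_subsingleton] at hext
  rw [isZero_localCohomology_iff]
  intro h
  apply hext
  refine subsingleton_of_forall_eq 0 fun x ↦ ?_
  obtain ⟨s, hs, hx⟩ := h 1 x
  let p : (R ⧸ a ^ s) →ₗ[R] R ⧸ a ^ 1 := Submodule.factor (Ideal.pow_le_pow_right hs)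
  have hsurj : Function.Surjective p := Submodule.factor_surjective _
  -- The kernel of `R/a^s → R/a` is killed by the `s`-th powers of `xs`, a weakly regular sequence
  -- of the same length, so its Ext vanishes just below the critical degree and the transition map
  -- is injective.
  have hS := LinearMap.shortExact_shortComplexKer hsurj
  have hreg' : IsWeaklyRegular N (xs.map (· ^ s)) := by
    simpa using isWeaklyRegular_append_map_pow (N := N) hs xs [] (by simpa using hmem)
      (by simpa using hreg)
  have hK : ∀ r ∈ xs.map (· ^ s), r ∈ Module.annihilator R (LinearMap.ker p) := by
    intro r hr
    have hra : r ∈ a ^ s := ofList_map_pow_le xs s (Ideal.subset_span (s := {x | x ∈ xs.map (· ^ s)}) hr)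
    refine LinearMap.annihilator_le_of_injective (LinearMap.ker p).subtype
      (Submodule.injective_subtype _) ?_
    rwa [Ideal.annihilator_quotient]
  have hm : Mono (((Ext R (ModuleCat.{u} R) xs.length).map (ModuleCat.ofHom p).op).app
      (ModuleCat.of R N)) := by
    refine mono_ext_map_app _ _ _ fun α hα ↦ ?_
    refine ext_eq_zero_of_mk₀_comp_eq_zero hS (fun k hk ↦ ?_) α hα
    exact subsingleton_ext_of_isWeaklyRegular (ModuleCat.of R (LinearMap.ker p))
        hreg' hK (by simp; omega)
  exact (injective_iff_map_eq_zero _).1 ((ModuleCat.mono_iff_injective _).1 hm) x hx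

lemma cd_ofList_eq_length [Nontrivial R] (xs : List R) (hJ : Ideal.ofList xs ≤ Ring.jacobson R)
    (hreg : IsWeaklyRegular R xs) : cd (Ideal.ofList xs) R = ((xs.length : ℕ∞) : WithBot ℕ∞) := by
  apply le_antisymm
  · refine iSup_le fun ⟨i, hi⟩ ↦ ?_
    by_contra hlt
    refine hi (isZero_localCohomology_of_isWeaklyRegular xs hJ hreg _ ?_)
    by_contra! hle
    exact hlt (by exact_mod_cast hle)
  · exact le_iSup (fun i : {i : ℕ // ¬ CategoryTheory.Limits.IsZero
      ((localCohomology (Ideal.ofList xs) i).obj (ModuleCat.of R R))} ↦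
        (((i : ℕ) : ℕ∞) : WithBot ℕ∞))
      ⟨xs.length, not_isZero_localCohomology_of_isWeaklyRegular xs hJ R hreg⟩

end CohomologicalDimension

/-! ### Grade and its upper bound -/

section Grade

lemma smul_top_ne_top {R : Type u} [CommRing R] {a : Ideal R} (ha : a ≤ Ring.jacobson R)
    (M : Type v) [AddCommGroup M] [Module R M] [Module.Finite R M] [Nontrivial M] :
    (a • ⊤ : Submodule R M) ≠ ⊤ :=
  (Submodule.top_ne_ideal_smul_of_le_jacobson_annihilator
    (ha.trans Ideal.ringJacobson_le_jacobson)).symm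

lemma grade_eq_iSup {R : Type u} [CommRing R] {a : Ideal R} {M : Type v} [AddCommGroup M]
    [Module R M] (h : (a • ⊤ : Submodule R M) ≠ ⊤) :
    grade a M = ⨆ rs : {rs : List R // (∀ r ∈ rs, r ∈ a) ∧ IsRegular M rs},
      (rs.1.length : ℕ∞) :=
  if_neg h

lemma length_le_grade {R : Type u} [CommRing R] {a : Ideal R} {M : Type v} [AddCommGroup M]
    [Module R M] {rs : List R} (hmem : ∀ r ∈ rs, r ∈ a) (hrs : IsRegular M rs) :
    (rs.length : ℕ∞) ≤ grade a M := by
  by_cases h : (a • ⊤ : Submodule R M) = ⊤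
  · rw [grade, if_pos h]
    exact le_top
  · rw [grade_eq_iSup h]
    exact le_iSup (fun rs : {rs : List R // (∀ r ∈ rs, r ∈ a) ∧ IsRegular M rs} ↦
      (rs.1.length : ℕ∞)) ⟨rs, hmem, hrs⟩

lemma exists_isRegular_of_grade_eq {R : Type u} [CommRing R] {a : Ideal R} {M : Type v}
    [AddCommGroup M] [Module R M] [Nontrivial M] (h : (a • ⊤ : Submodule R M) ≠ ⊤) {n : ℕ}
    (hn : grade a M = n) : ∃ rs : List R, (∀ r ∈ rs, r ∈ a) ∧ IsRegular M rs ∧ rs.length = n := by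
  rw [grade_eq_iSup h] at hn
  have : Nonempty {rs : List R // (∀ r ∈ rs, r ∈ a) ∧ IsRegular M rs} :=
    ⟨[], by simp, IsRegular.nil R M⟩
  obtain ⟨⟨rs, hmem, hrs⟩, hlen⟩ := ENat.exists_eq_iSup_of_lt_top
    (f := fun rs : {rs : List R // (∀ r ∈ rs, r ∈ a) ∧ IsRegular M rs} ↦ (rs.1.length : ℕ∞))
    (by rw [hn]; exact ENat.natCast_lt_top n)
  exact ⟨rs, hmem, hrs, by exact_mod_cast hlen.trans hn⟩

lemma grade_le_spanFinrank {R : Type u} [CommRing R] [IsNoetherianRing R] {a : Ideal R}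
    (ha : a ≤ Ring.jacobson R) (M : Type v) [AddCommGroup M] [Module R M] [Module.Finite R M]
    [Nontrivial M] : grade a M ≤ (Submodule.spanFinrank a : ℕ∞) := by
  rw [grade_eq_iSup (smul_top_ne_top ha M)]
  refine iSup_le fun ⟨rs, hmem, hrs⟩ ↦ ?_
  -- The Ext lemmas need a module in the universe of `R`.
  have : Small.{u} M := Module.Finite.small R M
  let e := Shrink.linearEquiv.{u} R M
  have : Module.Finite R (Shrink.{u} M) := Module.Finite.equiv e.symm
  exact_mod_cast length_le_spanFinrank_of_isWeaklyRegular a (Shrink.{u} M)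
    (smul_top_ne_top ha _) ((e.isWeaklyRegular_congr rs).2 hrs.1) hmem

end Grade

/-! ### Generators regular on both `M` and `R` -/

section CommonGenerators

variable {R : Type u} [CommRing R] [IsNoetherianRing R]

lemma exists_common_isRegular_generators {a : Ideal R} (ha : a ≤ Ring.jacobson R) [Nontrivial R]
    (M : Type v) [AddCommGroup M] [Module R M] [Module.Finite R M] [Nontrivial M]
    (hM : grade a M = (Submodule.spanFinrank a : ℕ∞))
    (hR : grade a R = (Submodule.spanFinrank a : ℕ∞)) :
    ∃ rs : List R, Ideal.ofList rs = a ∧ IsRegular M rs ∧ IsRegular R rs := by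
  obtain ⟨us, husa, hus, husl⟩ := exists_isRegular_of_grade_eq (smul_top_ne_top ha M) hM
  obtain ⟨vs, hvsa, hvs, hvsl⟩ := exists_isRegular_of_grade_eq (smul_top_ne_top ha R) hR
  obtain ⟨xs, hlen, hxs⟩ := exists_list_length_eq_spanFinrank a
  have : Small.{u} M := Module.Finite.small R M
  let e := Shrink.linearEquiv.{u} R M
  have : Module.Finite R (Shrink.{u} M) := Module.Finite.equiv e.symm
  obtain ⟨ys, -, hys, hysM, hysR⟩ := exists_common_isWeaklyRegular_generators a xs ⊥
    (Shrink.{u} M) R bot_le bot_le (by simp [hxs])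
    (fun i hi ↦ subsingleton_ext_of_isWeaklyRegular _ ((e.isWeaklyRegular_congr us).2 hus.1)
      (by simpa [Ideal.annihilator_quotient] using husa) (by omega))
    (fun i hi ↦ subsingleton_ext_of_isWeaklyRegular _ hvs.1
      (by simpa [Ideal.annihilator_quotient] using hvsa) (by omega))
  rw [bot_sup_eq] at hys
  exact ⟨ys, hys.symm, ⟨(e.isWeaklyRegular_congr ys).1 hysM, hys ▸ (smul_top_ne_top ha M).symm⟩,
    ⟨hysR, hys ▸ (smul_top_ne_top ha R).symm⟩⟩

end CommonGenerators

end RelativeRegular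

theorem theorem4 {R : Type u} [CommRing R] [IsNoetherianRing R]
    (a : Ideal R) (ha : a ≤ Ring.jacobson R)
    (M : Type v) [AddCommGroup M] [Module R M] [Module.Finite R M] [Nontrivial M] :
    RelativeRegular.IsRelativeRegular a M ↔
      (RelativeRegular.grade a M = RelativeRegular.grade a R ∧
        RelativeRegular.grade a R = (Submodule.spanFinrank a : ℕ∞)) := by
  have : Nontrivial R := Module.nontrivial R M
  constructor
  · rintro (h | ⟨-, rs, hrs, hM, hR, -⟩)
    · exact absurd h.symm (RelativeRegular.smul_top_ne_top ha M)
    · have hmem : ∀ r ∈ rs, r ∈ a := fun r hr ↦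
        hrs ▸ Ideal.subset_span (s := {x | x ∈ rs}) hr
      have hle : (Submodule.spanFinrank a : ℕ∞) ≤ rs.length := by
        exact_mod_cast hrs ▸ RelativeRegular.spanFinrank_ofList_le rs
      have hgM := le_antisymm (RelativeRegular.grade_le_spanFinrank ha M)
        (hle.trans (RelativeRegular.length_le_grade hmem hM))
      have hgR := le_antisymm (RelativeRegular.grade_le_spanFinrank ha R)
        (hle.trans (RelativeRegular.length_le_grade hmem hR))
      exact ⟨hgM.trans hgR.symm, hgR⟩
  · rintro ⟨h₁, h₂⟩
    obtain ⟨rs, hrs, hM, hR⟩ :=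
      RelativeRegular.exists_common_isRegular_generators ha M (h₁.trans h₂) h₂
    refine Or.inr ⟨(RelativeRegular.smul_top_ne_top ha M).symm, rs, hrs, hM, hR, ?_⟩
    subst hrs
    exact (RelativeRegular.cd_ofList_eq_length rs ha hR.1).symm
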